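/- All Banach spaces are real, and $k$ is a positive integer or $\infty$. A $C^k$ bump function on a Banach space $X$ is a function $X\to\mathbb R$ of class $C^k$ (in the Fréchet sense) with bounded, non-empty support. For a set $L$, let $\ell_\infty(L)$ be the space of bounded real functions on $L$ and $c_0(L)$ its subspace of all $x$ such that $\{t\in L: |x_t|\ge\varepsilon\}$ is finite for every $\varepsilon>0$, both with the supremum norm $\|\cdot\|_\infty$. Let $U(L)$ be the set of all pairs $(f,x)\in\ell_\infty(L)\oplus c_0(L)$ such that $\|f\|_\infty$ and $\|x\|_\infty$ are both strictly less than $\big\||f|+\tfrac12|x|\big\|_\infty$. For a locally compact space $L$ and a Banach space $E$, let $C_0(L;E)$ be the Banach space of continuous functions $L\to E$ vanishing at infinity, with the supremum norm, and $C_0(L)=C_0(L;\mathbb R)$, regarded as a subspace of $\ell_\infty(L)$. A function $\phi:C_0(L)\to\mathbb R$ depends locally on finitely many coordinates if every $f^0\in C_0(L)$ has an open neighbourhood $G$ for which there is a finite set $M\subseteq L$ such that $\phi(f)=\phi(g)$ whenever $f,g\in G$ agree on $M$. Let $L$ be a locally compact space such that there exists a continuous map $T:C_0(L)\to c_0(L)$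 satisfying 1. for all $f\in C_0(L)$ the pair $(f,Tf)$ is in $U(L)\cup\{0\}$; 2. for each $t\in L$ the coordinate $f\mapsto (Tf)_t$ is a $C^k$ function on $C_0(L)$ depending locally on finitely many coordinates. Let $E$ be a Banach space admitting a $C^k$ bump function. Then the space $C_0(L;E)$ also admits a $C^k$ bump function. In particular, if each of the spaces $L_1,\dots,L_n$ is homeomorphic to an ordinal (with its order topology), then $C_0(L_1\times\dots\times L_n;E)$ admits a $C^k$ bump function whenever the Banach space $E$ does. -/

import Mathlib

open scoped ENNReal ZeroAtInfty
open Topology Filter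

universe u v w

/-- The real Banach space `ℓ_∞(L)` of bounded real functions on the set `L`, with the sup norm. -/
abbrev EllInfty (L : Type u) : Type u := lp (fun _ : L => ℝ) ∞

/-- The real Banach space `c₀(L)` on the set `L` (no topology on `L` is involved): the subspace of
`ℓ_∞(L)` of all `x` such that, for every `ε > 0`, one has `|x t| < ε` for all but finitely
many `t`. -/
def cZero (L : Type u) : Submodule ℝ (EllInfty L) where
  carrier := {x | Tendsto (fun t : L => x t) cofinite (𝓝 0)}
  add_mem' := by
    intro a b ha hb
    simpa using Tendsto.add ha hb
  zero_mem' := by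
    simpa using (tendsto_const_nhds : Tendsto (fun _ : L => (0 : ℝ)) cofinite (𝓝 0))
  smul_mem' := by
    intro c x hx
    simpa using Tendsto.const_mul c hx

/-- The sup norm of the bounded function `|f| + ½ |x|`. -/
noncomputable def supAbsAddHalfAbs {L : Type u} (f : EllInfty L) (x : cZero L) : ℝ :=
  ⨆ t : L, (|f t| + |x.1 t| / 2)

/-- The set `U(L)` of all pairs `(f, x)` in `ℓ_∞(L) ⊕ c₀(L)` such that `‖f‖` and `‖x‖` are both
strictly less than the sup norm of `|f| + ½ |x|`. -/
def talagrandSet (L : Type u) : Set (EllInfty L × cZero L) :=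
  {p | ‖p.1‖ < supAbsAddHalfAbs p.1 p.2 ∧ ‖p.2‖ < supAbsAddHalfAbs p.1 p.2}

/-- The inclusion of `C₀(L)` in `ℓ_∞(L)`. -/
def toEllInfty {L : Type u} [TopologicalSpace L] (f : C₀(L, ℝ)) : EllInfty L :=
  ⟨fun t => f t, memℓp_infty ⟨‖f.toBCF‖, by
    rintro _ ⟨t, rfl⟩
    exact f.toBCF.norm_coe_le_norm t⟩⟩

/-- A function on `C₀(L)` depends locally on finitely many coordinates. -/
def DependsLocallyOnFinitelyManyCoords {L : Type u} [TopologicalSpace L]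
    (φ : C₀(L, ℝ) → ℝ) : Prop :=
  ∀ f₀ : C₀(L, ℝ), ∃ G : Set C₀(L, ℝ), IsOpen G ∧ f₀ ∈ G ∧ ∃ M : Finset L,
    ∀ f ∈ G, ∀ g ∈ G, (∀ t ∈ M, f t = g t) → φ f = φ g

/-- `X` admits a bump function of class `C^k`: a `C^k` real function with bounded, non-empty
support. Here `k` is a natural number or `∞` (never analyticity). -/
def AdmitsBump (k : ℕ∞) (X : Type u) [NormedAddCommGroup X] [NormedSpace ℝ X] : Prop :=
  ∃ φ : X → ℝ, ContDiff ℝ k φ ∧ (Function.support φ).Nonempty ∧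
    Bornology.IsBounded (Function.support φ)

/-! Take a bump `φ` on `E` with `φ 0 = 1`, put `ρ = 1 - φ` and `S f = ρ ∘ f`. If `‖S f‖ < 1`, then
`φ (f t)` never vanishes, so `f` is bounded by a fixed constant. It remains to cut off smoothly at
`‖S f‖ = 1`: multiply smooth functions of `(S f t, (T (S f)) t)` over all `t`. Where `‖S f‖ < 1`,
only finitely many factors locally differ from `1`, since `T` is continuous into `c₀`. Where `‖S f‖
≥ 1`, membership in `U(L)` yields a `t` whose factor vanishes nearby (`AdmitsBump.zeroAtInfty`). On
an ordinal, `T f t = (f t - f (t + 1)) / 2` works: it is nonzero at the last point where `|f|`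
attains its norm. Finite products follow by currying and induction. -/

namespace ZeroAtInftyContinuousMap

/-! ### Functions vanishing at infinity and composition -/

section General

variable {L : Type u} [TopologicalSpace L] {E : Type w} [NormedAddCommGroup E]

theorem norm_apply_le (f : C₀(L, E)) (t : L) : ‖f t‖ ≤ ‖f‖ :=
  f.toBCF.norm_coe_le_norm t

theorem norm_le_of_forall_le {f : C₀(L, E)} {C : ℝ} (hC : 0 ≤ C) (h : ∀ t, ‖f t‖ ≤ C) :
    ‖f‖ ≤ C :=
  (BoundedContinuousFunction.norm_le (f := f.toBCF) hC).2 h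

theorem exists_compact_norm_lt (f : C₀(L, E)) {ε : ℝ} (hε : 0 < ε) : ∃ K : Set L, IsCompact K ∧ ∀ x ∉ K, ‖f x‖ < ε := by
  have h := f.zero_at_infty'.norm
  rw [norm_zero] at h
  exact mem_cocompact.1 (h.eventually (gt_mem_nhds hε))

/-- Composition on the left with a continuous function vanishing at the origin. -/
def postcomp (ρ : E → ℝ) (hρ : Continuous ρ) (h0 : ρ 0 = 0) (f : C₀(L, E)) : C₀(L, ℝ) where
  toFun t := ρ (f t)
  continuous_toFun := hρ.comp f.continuous
  zero_at_infty' := by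
    have h := (hρ.tendsto 0).comp f.zero_at_infty'
    rwa [h0] at h

@[simp]
theorem postcomp_apply (ρ : E → ℝ) (hρ : Continuous ρ) (h0 : ρ 0 = 0) (f : C₀(L, E)) (t : L) :
    postcomp ρ hρ h0 f t = ρ (f t) := rfl

theorem continuous_postcomp (ρ : E → ℝ) (hρ : Continuous ρ) (h0 : ρ 0 = 0) :
    Continuous (postcomp (L := L) ρ hρ h0) := by
  rw [Metric.continuous_iff]
  intro f ε hε
  -- `ρ` need not be uniformly continuous, but it is so near this compact set, which contains all
  -- values of `f`.
  have hK : IsCompact (insert 0 (Set.range f)) :=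
    f.zero_at_infty'.isCompact_insert_range_of_cocompact f.continuous
  obtain ⟨δ, hδ, h⟩ := Metric.mem_uniformity_dist.1
    (hK.uniformContinuousAt_of_continuousAt ρ (fun a _ => hρ.continuousAt)
      (Metric.dist_mem_uniformity (half_pos hε)))
  refine ⟨δ, hδ, fun g hg => ?_⟩
  rw [dist_eq_norm] at hg ⊢
  refine lt_of_le_of_lt (norm_le_of_forall_le (half_pos hε).le fun t => ?_) (half_lt_self hε)
  have hd : dist (f t) (g t) < δ := by
    rw [dist_comm, dist_eq_norm]
    exact (norm_apply_le (g - f) t).trans_lt hg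
  have := h hd (Set.mem_insert_of_mem _ ⟨t, rfl⟩)
  rw [Set.mem_ofPred_eq, dist_comm, dist_eq_norm] at this
  exact this.le

variable [NormedSpace ℝ E]

/-- Evaluation at a point, as a continuous linear map. -/
noncomputable def evalL (t : L) : C₀(L, E) →L[ℝ] E :=
  LinearMap.mkContinuous
    { toFun := fun f => f t, map_add' := fun _ _ => rfl, map_smul' := fun _ _ => rfl } 1
    (fun f => by simpa using norm_apply_le f t)

theorem contDiff_apply {n : WithTop ℕ∞} (t : L) : ContDiff ℝ n fun f : C₀(L, E) => f t :=
  (evalL t : C₀(L, E) →L[ℝ] E).contDiff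

/-- Restriction to a finite set of points, as a continuous linear map. -/
noncomputable def restrictL (M : Finset L) : C₀(L, E) →L[ℝ] (M → E) :=
  ContinuousLinearMap.pi fun t => evalL t.1

/-- Restriction of scalar functions to a finite set of points has a continuous generalized
inverse. -/
theorem exists_extension (M : Finset L) :
    ∃ R : (M → ℝ) →L[ℝ] C₀(L, ℝ), ∀ f : C₀(L, ℝ), ∀ t ∈ M, R (restrictL M f) t = f t := by
  set r : C₀(L, ℝ) →ₗ[ℝ] (M → ℝ) := (restrictL M).toLinearMap with hr
  obtain ⟨g, hg⟩ := r.rangeRestrict.exists_rightInverse_of_surjective r.range_rangeRestrict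
  obtain ⟨p, hp⟩ := LinearMap.exists_leftInverse_of_injective (LinearMap.range r).subtype
    (LinearMap.range r).ker_subtype
  refine ⟨(g ∘ₗ p).toContinuousLinearMap, fun f t ht => ?_⟩
  have h1 : p (r f) = r.rangeRestrict f := LinearMap.congr_fun hp (r.rangeRestrict f)
  have h2 : r.rangeRestrict (g (r.rangeRestrict f)) = r.rangeRestrict f :=
    LinearMap.congr_fun hg _
  have h3 : r (g (p (r f))) = r f := by
    rw [h1]
    exact congrArg Subtype.val h2
  exact congrFun h3 ⟨t, ht⟩

end General

/-- If `φ` is of class `C^k` and depends locally on finitely many coordinates, then so is its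
composition with `f ↦ ρ ∘ f`. -/
theorem contDiff_comp_postcomp {L : Type u} [TopologicalSpace L] {E : Type w}
    [NormedAddCommGroup E] [NormedSpace ℝ E] {n : WithTop ℕ∞} {φ : C₀(L, ℝ) → ℝ}
    (hφ : ContDiff ℝ n φ) (hd : DependsLocallyOnFinitelyManyCoords φ)
    {ρ : E → ℝ} (hρ : ContDiff ℝ n ρ) (h0 : ρ 0 = 0) :
    ContDiff ℝ n (fun f : C₀(L, E) => φ (postcomp ρ hρ.continuous h0 f)) := by
  rw [contDiff_iff_contDiffAt]
  intro f₀
  obtain ⟨G, hG, hf₀, M, hM⟩ := hd (postcomp ρ hρ.continuous h0 f₀)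
  obtain ⟨R, hR⟩ := exists_extension M
  set S := postcomp (L := L) ρ hρ.continuous h0 with hS
  have hSc : Continuous S := continuous_postcomp ρ hρ.continuous h0
  -- `S` is merely continuous, but `q` sees only finitely many coordinates of `S f`, so it is `C^n`.
  -- It agrees with `S f` on `M`, and near `f₀` both lie in `G`.
  set q : C₀(L, E) → C₀(L, ℝ) := fun f => S f₀ + R (restrictL M (S f - S f₀)) with hq
  have hrc : ContDiff ℝ n (fun f : C₀(L, E) => restrictL M (S f)) :=
    contDiff_pi.2 fun t => hρ.comp (contDiff_apply t.1)
  have hqd : ContDiff ℝ n q := by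
    simp only [hq, map_sub]
    exact contDiff_const.add (((R.contDiff).comp hrc).sub contDiff_const)
  have hq₀ : q f₀ = S f₀ := by simp [hq]
  refine (hφ.comp hqd).contDiffAt.congr_of_eventuallyEq ?_
  filter_upwards [hSc.continuousAt.preimage_mem_nhds (hG.mem_nhds hf₀),
    hqd.continuous.continuousAt.preimage_mem_nhds (hG.mem_nhds (hq₀.symm ▸ hf₀))] with f h1 h2
  refine hM _ h1 _ h2 fun t ht => ?_
  have := hR (S f - S f₀) t ht
  simp only [hq, add_apply, this, sub_apply]
  ring

end ZeroAtInftyContinuousMap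

open ZeroAtInftyContinuousMap

/-! ### The cutoff in one coordinate -/

section Cutoff

/-- A function on `(-1, 1) × ℝ` that is `1` near `(-1, 1) × {0}` and vanishes where
`|v| ≥ 1 - u ^ 2`. -/
noncomputable def coordCutoff (u v : ℝ) : ℝ :=
  1 - Real.smoothTransition (2 * (v / (1 - u ^ 2)) ^ 2 - 1)

theorem contDiffAt_coordCutoff {X : Type*} [NormedAddCommGroup X] [NormedSpace ℝ X]
    {n : ℕ∞} {a b : X → ℝ} {x : X} (ha : ContDiffAt ℝ n a x) (hb : ContDiffAt ℝ n b x)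
    (hx : |a x| < 1) : ContDiffAt ℝ n (fun y => coordCutoff (a y) (b y)) x := by
  have h : 1 - a x ^ 2 ≠ 0 := (sub_pos.2 ((sq_lt_one_iff_abs_lt_one _).2 hx)).ne'
  exact contDiffAt_const.sub (Real.smoothTransition.contDiff.contDiffAt.comp x
    ((contDiffAt_const.mul ((hb.div (contDiffAt_const.sub (ha.pow 2)) h).pow 2)).sub
      contDiffAt_const))

theorem coordCutoff_eq_one {u v c : ℝ} (hc : c < 1) (hu : |u| ≤ c) (hv : |v| ≤ (1 - c ^ 2) / 2) :
    coordCutoff u v = 1 := by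
  have hc0 : 0 ≤ c := (abs_nonneg u).trans hu
  have hu2 : u ^ 2 ≤ c ^ 2 := sq_le_sq.2 (by rwa [abs_of_nonneg hc0])
  have hpos : 0 < 1 - u ^ 2 := by nlinarith
  have h : |v / (1 - u ^ 2)| ≤ 1 / 2 := by
    rw [abs_div, abs_of_pos hpos, div_le_iff₀ hpos]
    linarith
  have h2 : (v / (1 - u ^ 2)) ^ 2 ≤ (1 / 2) ^ 2 :=
    sq_le_sq.2 (by rwa [abs_of_pos (one_half_pos (α := ℝ))])
  rw [coordCutoff, Real.smoothTransition.zero_of_nonpos (by linarith), sub_zero]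

/-- The weight `1/2` enters here: `|v| > 2 (1 - |u|) ≥ (1 + |u|) (1 - |u|) = 1 - u ^ 2`. -/
theorem coordCutoff_eq_zero {u v : ℝ} (hu : |u| < 1) (h : 1 < |u| + |v| / 2) :
    coordCutoff u v = 0 := by
  have hpos : 0 < 1 - u ^ 2 := sub_pos.2 ((sq_lt_one_iff_abs_lt_one _).2 hu)
  have hv : 1 ≤ |v / (1 - u ^ 2)| := by
    rw [abs_div, abs_of_pos hpos, le_div_iff₀ hpos, ← sq_abs u]
    nlinarith [abs_nonneg u]
  have h2 : 1 ≤ (v / (1 - u ^ 2)) ^ 2 := by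
    rw [← sq_abs]
    nlinarith
  rw [coordCutoff, Real.smoothTransition.one_of_one_le (by linarith), sub_self]

end Cutoff

/-! ### The bump function built from `T` -/

section Bump

/-- A bump function can be normalized to take the value `1` at the origin. -/
theorem AdmitsBump.exists_normalized {k : ℕ∞} {E : Type w} [NormedAddCommGroup E]
    [NormedSpace ℝ E] (h : AdmitsBump k E) :
    ∃ φ : E → ℝ, ContDiff ℝ k φ ∧ φ 0 = 1 ∧ ∃ R, ∀ x, φ x ≠ 0 → ‖x‖ ≤ R := by
  obtain ⟨φ, hφ, ⟨x₀, hx₀⟩, hb⟩ := h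
  obtain ⟨R, hR⟩ := hb.exists_norm_le
  refine ⟨fun x => φ (x₀ + x) / φ x₀, (hφ.comp (contDiff_const.add contDiff_id)).div_const _,
    by simpa using div_self hx₀, R + ‖x₀‖, fun x hx => ?_⟩
  have h1 := hR (x₀ + x) (fun h => hx (by simp [h]))
  calc ‖x‖ = ‖x₀ + x - x₀‖ := by simp
    _ ≤ ‖x₀ + x‖ + ‖x₀‖ := norm_sub_le _ _
    _ ≤ R + ‖x₀‖ := by gcongr

/-- Normalizing at the origin keeps the support of `φ ∘ J` non-empty, even if the range of `J`
misses the original support. -/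
theorem AdmitsBump.of_norm_le {k : ℕ∞} {X : Type u} {Y : Type v} [NormedAddCommGroup X]
    [NormedSpace ℝ X] [NormedAddCommGroup Y] [NormedSpace ℝ Y] (h : AdmitsBump k Y)
    (J : X →L[ℝ] Y) (hJ : ∀ x, ‖x‖ ≤ ‖J x‖) : AdmitsBump k X := by
  obtain ⟨φ, hφ, h1, R, hR⟩ := h.exists_normalized
  refine ⟨φ ∘ J, hφ.comp J.contDiff, ⟨0, by simp [h1]⟩, ?_⟩
  exact isBounded_iff_forall_norm_le.2 ⟨R, fun x hx => (hJ x).trans (hR _ hx)⟩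

variable {L : Type u}

theorem exists_lt_of_lt_supAbsAddHalfAbs {f : EllInfty L} {x : cZero L}
    (h : ‖f‖ < supAbsAddHalfAbs f x) : ∃ t, ‖f‖ < |f t| + |x.1 t| / 2 := by
  by_contra! hc
  exact h.not_ge (Real.iSup_le hc (norm_nonneg f))

theorem lt_supAbsAddHalfAbs {f : EllInfty L} {x : cZero L} {c : ℝ} (t : L)
    (h : c < |f t| + |x.1 t| / 2) : c < supAbsAddHalfAbs f x := by
  refine h.trans_le (le_ciSup (f := fun t : L => |f t| + |x.1 t| / 2) ⟨‖f‖ + ‖x.1‖ / 2, ?_⟩ t)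
  rintro _ ⟨s, rfl⟩
  have h1 := lp.norm_apply_le_norm ENNReal.top_ne_zero f s
  have h2 := lp.norm_apply_le_norm ENNReal.top_ne_zero x.1 s
  rw [Real.norm_eq_abs] at h1 h2
  dsimp only
  linarith

variable [TopologicalSpace L]

theorem norm_toEllInfty (f : C₀(L, ℝ)) : ‖toEllInfty f‖ = ‖f‖ := by
  refine le_antisymm (lp.norm_le_of_forall_le (norm_nonneg _) fun t => norm_apply_le f t) ?_
  exact norm_le_of_forall_le (norm_nonneg _)
    fun t => lp.norm_apply_le_norm ENNReal.top_ne_zero (toEllInfty f) t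

theorem AdmitsBump.zeroAtInfty {k : ℕ∞} {E : Type w} [NormedAddCommGroup E] [NormedSpace ℝ E]
    (hE : AdmitsBump k E) (T : C₀(L, ℝ) → cZero L) (hT : Continuous T)
    (hU : ∀ f : C₀(L, ℝ), (toEllInfty f, T f) ∈ talagrandSet L ∪ {0})
    (hc : ∀ t : L, ContDiff ℝ k (fun f : C₀(L, ℝ) => (T f).1 t) ∧
      DependsLocallyOnFinitelyManyCoords (fun f : C₀(L, ℝ) => (T f).1 t)) :
    AdmitsBump k C₀(L, E) := by
  classical
  obtain ⟨φ, hφ, hφ0, R, hR⟩ := hE.exists_normalized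
  set ρ : E → ℝ := fun e => 1 - φ e with hρdef
  have hρ : ContDiff ℝ k ρ := contDiff_const.sub hφ
  have h0 : ρ 0 = 0 := by simp [hρdef, hφ0]
  set S := postcomp (L := L) ρ hρ.continuous h0 with hS
  have hSc : Continuous S := continuous_postcomp ρ hρ.continuous h0
  have hSt : ∀ t, ContDiff ℝ k (fun f => S f t) := fun t => hρ.comp (contDiff_apply t)
  have hTt : ∀ t, ContDiff ℝ k (fun f => (T (S f)).1 t) :=
    fun t => contDiff_comp_postcomp (hc t).1 (hc t).2 hρ h0
  -- Otherwise `‖T 0‖` would be less than the norm of `½ |T 0|`.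
  have hT0 : T 0 = 0 := by
    rcases hU 0 with h | h
    · obtain ⟨h1, h2⟩ := h
      have : supAbsAddHalfAbs (toEllInfty (0 : C₀(L, ℝ))) (T 0) ≤ ‖T 0‖ := by
        refine Real.iSup_le (fun t => ?_) (norm_nonneg _)
        have h3 := lp.norm_apply_le_norm ENNReal.top_ne_zero (T 0).1 t
        have h4 : toEllInfty (0 : C₀(L, ℝ)) t = 0 := rfl
        rw [Real.norm_eq_abs] at h3
        rw [h4, abs_zero, zero_add]
        have h5 : ‖T 0‖ = ‖(T 0).1‖ := rfl
        linarith [abs_nonneg ((T 0).1 t)]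
      exact absurd h2 this.not_gt
    · exact congrArg Prod.snd h
  set Ψ : C₀(L, E) → ℝ := fun f =>
    if ‖S f‖ < 1 then ∏ᶠ t, coordCutoff (S f t) ((T (S f)).1 t) else 0 with hΨ
  -- On `‖S f‖ < 1` the product is locally a finite product.
  have key : ∀ f₀, ‖S f₀‖ < 1 → ∃ M : Finset L, ∀ᶠ f in 𝓝 f₀, ‖S f‖ < 1 ∧
      ∀ t ∉ M, coordCutoff (S f t) ((T (S f)).1 t) = 1 := by
    intro f₀ hf₀
    obtain ⟨c, hc1, hc2⟩ := exists_between hf₀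
    have hc0 : 0 ≤ c := (norm_nonneg _).trans hc1.le
    set δ := (1 - c ^ 2) / 2 with hδ
    have hδ0 : 0 < δ := by
      have : c ^ 2 < 1 := by nlinarith
      linarith
    -- Half of the tolerance `δ` is for the tail of `T (S f₀)`, half for the perturbation of `f₀`.
    have hfin : {t | ¬ |(T (S f₀)).1 t| < δ / 2}.Finite := by
      have h := (T (S f₀)).2.abs
      rw [abs_zero] at h
      exact eventually_cofinite.1 (h.eventually (gt_mem_nhds (half_pos hδ0)))
    refine ⟨hfin.toFinset, ?_⟩
    filter_upwards [hSc.norm.continuousAt.eventually (gt_mem_nhds hc1),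
      (hT.comp hSc).continuousAt.eventually (Metric.ball_mem_nhds _ (half_pos hδ0))]
      with f h1 h2
    refine ⟨h1.trans hc2, fun t ht => ?_⟩
    refine coordCutoff_eq_one hc2 ((norm_apply_le (S f) t).trans h1.le) ?_
    have h3 : |(T (S f₀)).1 t| < δ / 2 := by simpa using ht
    have h4 : |(T (S f)).1 t - (T (S f₀)).1 t| < δ / 2 := by
      have h5 : dist (T (S f)) (T (S f₀)) < δ / 2 := h2
      rw [dist_eq_norm] at h5
      exact (lp.norm_apply_le_norm ENNReal.top_ne_zero (T (S f) - T (S f₀)).1 t).trans_lt h5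
    calc |(T (S f)).1 t| = |((T (S f)).1 t - (T (S f₀)).1 t) + (T (S f₀)).1 t| := by
          rw [sub_add_cancel]
      _ ≤ |(T (S f)).1 t - (T (S f₀)).1 t| + |(T (S f₀)).1 t| := abs_add_le _ _
      _ ≤ (1 - c ^ 2) / 2 := by linarith
  refine ⟨Ψ, ?_, ⟨0, ?_⟩, ?_⟩
  · rw [contDiff_iff_contDiffAt]
    intro f₀
    by_cases hf₀ : ‖S f₀‖ < 1
    · obtain ⟨M, hM⟩ := key f₀ hf₀
      have hprod : ContDiffAt ℝ k
          (fun f => ∏ t ∈ M, coordCutoff (S f t) ((T (S f)).1 t)) f₀ :=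
        contDiffAt_prod fun t _ => contDiffAt_coordCutoff (hSt t).contDiffAt (hTt t).contDiffAt
          ((norm_apply_le (S f₀) t).trans_lt hf₀)
      refine hprod.congr_of_eventuallyEq ?_
      filter_upwards [hM] with f hf
      rw [hΨ]
      dsimp only
      rw [if_pos hf.1]
      refine finprod_eq_prod_of_mulSupport_subset _ fun t ht => ?_
      by_contra htM
      exact ht (hf.2 t htM)
    · have hU' : (toEllInfty (S f₀), T (S f₀)) ∈ talagrandSet L := by
        refine (hU (S f₀)).resolve_right fun h => hf₀ ?_
        have h1 : toEllInfty (S f₀) = 0 := congrArg Prod.fst h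
        rw [← norm_toEllInfty, h1, norm_zero]
        exact one_pos
      obtain ⟨t, ht⟩ := exists_lt_of_lt_supAbsAddHalfAbs hU'.1
      have ht1 : 1 < |S f₀ t| + |(T (S f₀)).1 t| / 2 := by
        have h2 : ‖toEllInfty (S f₀)‖ < |S f₀ t| + |(T (S f₀)).1 t| / 2 := ht
        rw [norm_toEllInfty] at h2
        exact (not_lt.1 hf₀).trans_lt h2
      have hcont : Continuous fun f => |S f t| + |(T (S f)).1 t| / 2 :=
        (hSt t).continuous.abs.add ((hTt t).continuous.abs.div_const 2)
      refine (contDiffAt_const (c := (0 : ℝ))).congr_of_eventuallyEq ?_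
      filter_upwards [hcont.continuousAt.eventually (lt_mem_nhds ht1)] with f hf
      rw [hΨ]
      dsimp only
      split_ifs with h
      -- A `finprod` with infinite multiplicative support defaults to `1`, so the vanishing factor
      -- only helps once `key` gives finiteness.
      · obtain ⟨M, hM⟩ := key f h
        have hz := coordCutoff_eq_zero ((norm_apply_le (S f) t).trans_lt h) hf
        refine finprod_eq_zero _ t hz (M.finite_toSet.subset fun s hs => ?_)
        by_contra hsM
        exact hs (hM.self_of_nhds.2 s hsM)
      · rfl
  · have hS0 : S 0 = 0 := by
      ext t
      exact h0
    have h1 : ∀ t : L, coordCutoff ((0 : C₀(L, ℝ)) t) ((0 : cZero L).1 t) = 1 := fun t =>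
      coordCutoff_eq_one (c := 0) one_pos (by simp) (by simp)
    simp only [hΨ, Function.mem_support, hS0, hT0, norm_zero, one_pos, if_true, h1,
      finprod_one]
    exact one_ne_zero
  · refine isBounded_iff_forall_norm_le.2 ⟨max R 0, fun f hf => ?_⟩
    have hlt : ‖S f‖ < 1 := by
      by_contra h
      exact hf (if_neg h)
    refine norm_le_of_forall_le (le_max_right _ _) fun t => le_max_of_le_left (hR _ fun h => ?_)
    have h2 := norm_apply_le (S f) t
    have h3 : S f t = 1 := by simp [hS, hρdef, h]
    rw [h3, norm_one] at h2
    exact h2.not_gt hlt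

end Bump

/-! ### The operator `T` on a well-order -/

section WellOrder

/-- Every infinite subset of a well-order contains a strictly increasing sequence. -/
theorem Set.Infinite.exists_strictMono {α : Type*} [LinearOrder α] [WellFoundedLT α] {s : Set α}
    (hs : s.Infinite) : ∃ a : ℕ → α, StrictMono a ∧ ∀ n, a n ∈ s := by
  have := hs.to_subtype
  let e : ℕ ↪ s := _root_.Infinite.natEmbedding s
  obtain ⟨g, hg | hg⟩ := exists_increasing_or_nonincreasing_subseq (· < ·) fun n => (e n : α)
  · exact ⟨fun n => e (g n), fun m n h => hg m n h, fun n => (e (g n)).2⟩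
  · have hanti : StrictAnti fun n => (e (g n) : α) := fun m n h =>
      lt_of_le_of_ne (not_lt.1 (hg m n h)) fun heq =>
        h.ne' (g.injective (e.injective (Subtype.ext heq)))
    exact (not_strictAnti_of_wellFoundedLT _ hanti).elim

variable {L : Type u} [LinearOrder L] [SuccOrder L]

/-- The value of `f` at the successor of `t`, or `0` if `t` is maximal. -/
noncomputable def succValue (f : L → ℝ) (t : L) : ℝ :=
  open scoped Classical in if IsMax t then 0 else f (Order.succ t)

theorem abs_sub_succValue_le [TopologicalSpace L] (f : C₀(L, ℝ)) (t : L) : |(f t - succValue f t) / 2| ≤ ‖f‖ := by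
  have h1 := norm_apply_le f t
  have h2 : |succValue f t| ≤ ‖f‖ := by
    unfold succValue
    split_ifs
    · simp
    · exact norm_apply_le f _
  rw [Real.norm_eq_abs] at h1
  rw [abs_div, abs_two]
  linarith [abs_sub (f t) (succValue f t)]

variable [WellFoundedLT L] [TopologicalSpace L] [OrderTopology L]

/-- Infinitely many jumps of size at least `ε` would occur along a strictly increasing sequence `a
n`. Since `a n < succ (a n) ≤ a (n + 1)`, the points and their successors share a limit, either the
supremum or infinity, so the jumps tend to `0`. -/
theorem tendsto_apply_sub_succValue (f : C₀(L, ℝ)) :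
    Tendsto (fun t => f t - succValue f t) cofinite (𝓝 0) := by
  rw [Metric.tendsto_nhds]
  intro ε hε
  rw [eventually_cofinite]
  by_contra hinf
  obtain ⟨a, ha, hmem⟩ := Set.Infinite.exists_strictMono hinf
  have hnot : ∀ n, ¬ IsMax (a n) := fun n h => h.not_lt (ha n.lt_succ_self)
  have hsv : ∀ n, succValue f (a n) = f (Order.succ (a n)) := fun n => if_neg (hnot n)
  have hle : ∀ n, Order.succ (a n) ≤ a (n + 1) := fun n => Order.succ_le_of_lt (ha n.lt_succ_self)
  have hlim : Tendsto (fun n => f (a n) - f (Order.succ (a n))) atTop (𝓝 0) := by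
    by_cases hb : BddAbove (Set.range a)
    · obtain ⟨β, hβ⟩ : ∃ β, IsLUB (Set.range a) β := by
        obtain ⟨β, h1, h2⟩ := WellFounded.has_min (wellFounded_lt (α := L)) _ hb
        exact ⟨β, h1, fun b hb' => not_lt.1 (h2 b hb')⟩
      have h1 : Tendsto a atTop (𝓝 β) := tendsto_atTop_isLUB ha.monotone hβ
      have h2 : Tendsto (fun n => Order.succ (a n)) atTop (𝓝 β) :=
        tendsto_of_tendsto_of_tendsto_of_le_of_le h1 (h1.comp (tendsto_add_atTop_nat 1))
          (fun n => Order.le_succ _) hle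
      simpa using ((f.continuous.tendsto β).comp h1).sub ((f.continuous.tendsto β).comp h2)
    · have hex : ∀ b, ∃ n, b < a n := by
        intro b
        by_contra! h
        exact hb ⟨b, by rintro _ ⟨n, rfl⟩; exact h n⟩
      have : NoMaxOrder L := ⟨fun b => (hex b).imp' a fun _ h => h⟩
      have : Nonempty L := ⟨a 0⟩
      have h1 : Tendsto a atTop atTop :=
        tendsto_atTop_atTop_of_monotone ha.monotone fun b => (hex b).imp fun _ h => h.le
      have h2 : Tendsto (fun n => Order.succ (a n)) atTop atTop :=
        tendsto_atTop_mono (fun n => Order.le_succ _) h1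
      have hf : Tendsto f atTop (𝓝 0) := f.zero_at_infty'.mono_left atTop_le_cocompact
      simpa using (hf.comp h1).sub (hf.comp h2)
  obtain ⟨n, hn⟩ := (Metric.tendsto_nhds.1 hlim ε hε).exists
  refine hmem n ?_
  rwa [hsv]

/-- The operator `f ↦ (f t - f (t + 1)) / 2` from `C₀(L)` to `c₀(L)` on a well-order `L`. -/
noncomputable def succDiff : C₀(L, ℝ) →L[ℝ] cZero L :=
  LinearMap.mkContinuous
    { toFun := fun f => ⟨⟨fun t => (f t - succValue f t) / 2, memℓp_infty ⟨‖f‖, by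
          rintro _ ⟨t, rfl⟩
          exact abs_sub_succValue_le f t⟩⟩, by
          have h := (tendsto_apply_sub_succValue f).div_const 2
          rwa [zero_div] at h⟩
      map_add' := fun f g => by
        ext t
        change (f t + g t - succValue (f + g) t) / 2 =
          (f t - succValue f t) / 2 + (g t - succValue g t) / 2
        have : succValue (f + g) t = succValue f t + succValue g t := by
          unfold succValue
          split_ifs <;> simp
        rw [this]
        ring
      map_smul' := fun c f => by
        ext t
        change (c * f t - succValue (c • f) t) / 2 = c * ((f t - succValue f t) / 2)
        have : succValue (c • f) t = c * succValue f t := by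
          unfold succValue
          split_ifs <;> simp
        rw [this]
        ring } 1
    (fun f => by
      rw [one_mul]
      exact lp.norm_le_of_forall_le (norm_nonneg f) (abs_sub_succValue_le f))

theorem succDiff_apply (f : C₀(L, ℝ)) (t : L) :
    (succDiff f).1 t = (f t - succValue f t) / 2 := rfl

theorem succDiff_mem_talagrandSet {f : C₀(L, ℝ)} (hf : f ≠ 0) :
    (toEllInfty f, succDiff f) ∈ talagrandSet L := by
  obtain ⟨x₀, hx₀⟩ : ∃ x, f x ≠ 0 := by
    by_contra! h
    exact hf (ext h)
  have hlim : Tendsto (fun x => |f x|) (cocompact L) (𝓝 0) := by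
    simpa using f.zero_at_infty'.abs
  obtain ⟨x₁, hx₁⟩ := f.continuous.abs.exists_forall_ge' x₀
    ((hlim.eventually (gt_mem_nhds (abs_pos.2 hx₀))).mono fun _ h => h.le)
  have hpos : 0 < |f x₁| := (abs_pos.2 hx₀).trans_le (hx₁ x₀)
  have hK : IsCompact {x | |f x₁| ≤ |f x|} := by
    obtain ⟨K, hK, hKs⟩ := mem_cocompact.1 (hlim.eventually (gt_mem_nhds hpos))
    refine hK.of_isClosed_subset (isClosed_le continuous_const f.continuous.abs) fun x hx => ?_
    by_contra hxK
    have hx' : |f x₁| ≤ |f x| := hx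
    exact hx'.not_gt (hKs hxK)
  -- At the greatest maximizer of `|f|`, the successor has a different value; if `t` is the top, the
  -- default `0` differs from `f t`.
  obtain ⟨t, ht, htmax⟩ := hK.exists_isGreatest ⟨x₁, le_refl |f x₁|⟩
  have hnorm : ‖f‖ ≤ |f t| :=
    norm_le_of_forall_le (abs_nonneg _) fun x => (hx₁ x).trans ht
  have hne : f t - succValue f t ≠ 0 := by
    unfold succValue
    split_ifs with hm
    · rw [sub_zero]
      exact abs_pos.1 (hpos.trans_le ht)
    · intro h
      rw [sub_eq_zero] at h
      refine (Order.lt_succ_of_not_isMax hm).not_ge (htmax ?_)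
      rw [Set.mem_ofPred_eq, ← h]
      exact ht
  have hlt : ‖f‖ < supAbsAddHalfAbs (toEllInfty f) (succDiff f) := by
    refine lt_supAbsAddHalfAbs t ?_
    change ‖f‖ < |f t| + |(f t - succValue f t) / 2| / 2
    have : 0 < |(f t - succValue f t) / 2| := abs_pos.2 (div_ne_zero hne two_ne_zero)
    linarith
  exact ⟨by rwa [norm_toEllInfty], lt_of_le_of_lt
    (lp.norm_le_of_forall_le (norm_nonneg f) (abs_sub_succValue_le f)) hlt⟩

theorem dependsLocallyOnFinitelyManyCoords_succDiff (t : L) :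
    DependsLocallyOnFinitelyManyCoords (fun f : C₀(L, ℝ) => (succDiff f).1 t) := by
  refine fun _ => ⟨Set.univ, isOpen_univ, trivial, {t, Order.succ t}, fun f _ g _ h => ?_⟩
  simp only [succDiff_apply, succValue, h t (by simp), h (Order.succ t) (by simp)]

theorem AdmitsBump.zeroAtInfty_wellOrder {k : ℕ∞} {E : Type w} [NormedAddCommGroup E]
    [NormedSpace ℝ E] (hE : AdmitsBump k E) : AdmitsBump k C₀(L, E) := by
  refine hE.zeroAtInfty succDiff succDiff.continuous (fun f => ?_) fun t =>
    ⟨?_, dependsLocallyOnFinitelyManyCoords_succDiff t⟩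
  · by_cases hf : f = 0
    · right
      subst hf
      simp only [map_zero, Set.mem_singleton_iff]
      rfl
    · exact Or.inl (succDiff_mem_talagrandSet hf)
  · classical
    have h : ContDiff ℝ k (fun f : C₀(L, ℝ) =>
        (f t - (if IsMax t then (0 : C₀(L, ℝ) →L[ℝ] ℝ) else evalL (Order.succ t)) f) / 2) :=
      ((contDiff_apply t).sub (ContinuousLinearMap.contDiff _)).div_const (2 : ℝ)
    convert h using 3 with f
    rw [succDiff_apply, succValue]
    split_ifs <;> rfl

end WellOrder

/-! ### Finite products by currying -/

section Product

variable {A : Type u} {B : Type v} [TopologicalSpace A] [TopologicalSpace B]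
  {E : Type w} [NormedAddCommGroup E] [NormedSpace ℝ E]

/-- The section `b ↦ f (a, b)` of a function vanishing at infinity on a product. -/
def ZeroAtInftyContinuousMap.prodSection (f : C₀(A × B, E)) (a : A) : C₀(B, E) where
  toFun b := f (a, b)
  continuous_toFun := f.continuous.comp (by fun_prop)
  zero_at_infty' := by
    refine f.zero_at_infty'.comp fun s hs => ?_
    obtain ⟨K, hK, hKs⟩ := mem_cocompact.1 hs
    exact mem_cocompact.2 ⟨Prod.snd '' K, hK.image continuous_snd,
      fun b hb => hKs fun h => hb ⟨(a, b), h, rfl⟩⟩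

/-- Currying of functions vanishing at infinity on a product. -/
def ZeroAtInftyContinuousMap.curry (f : C₀(A × B, E)) : C₀(A, C₀(B, E)) where
  toFun := f.prodSection
  continuous_toFun := by
    refine continuous_iff_continuousAt.2 fun a₀ => Metric.tendsto_nhds.2 fun ε hε => ?_
    -- Off the projection of `K`, two terms below `ε / 4` add up to less than `ε / 2`.
    obtain ⟨K, hK, hKf⟩ := f.exists_compact_norm_lt (ε := ε / 4) (by positivity)
    have hev : ∀ᶠ a in 𝓝 a₀, ∀ b ∈ Prod.snd '' K, ‖f (a, b) - f (a₀, b)‖ < ε / 2 := by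
      refine (hK.image continuous_snd).eventually_forall_of_forall_eventually
        (P := fun a b => ‖f (a, b) - f (a₀, b)‖ < ε / 2) fun b _ => ?_
      have hcont : Continuous fun z : A × B => ‖f (z.1, z.2) - f (a₀, z.2)‖ :=
        ((f.continuous.comp (by fun_prop)).sub (f.continuous.comp (by fun_prop))).norm
      exact hcont.continuousAt.eventually (gt_mem_nhds (by simpa using hε))
    filter_upwards [hev] with a ha
    rw [dist_eq_norm]
    refine lt_of_le_of_lt (norm_le_of_forall_le (half_pos hε).le fun b => ?_) (half_lt_self hε)
    change ‖f (a, b) - f (a₀, b)‖ ≤ ε / 2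
    by_cases hb : b ∈ Prod.snd '' K
    · exact (ha b hb).le
    · have h1 := hKf (a, b) fun h => hb ⟨_, h, rfl⟩
      have h2 := hKf (a₀, b) fun h => hb ⟨_, h, rfl⟩
      linarith [norm_sub_le (f (a, b)) (f (a₀, b))]
  zero_at_infty' := by
    refine Metric.tendsto_nhds.2 fun ε hε => ?_
    obtain ⟨K, hK, hKf⟩ := f.exists_compact_norm_lt (half_pos hε)
    refine mem_cocompact.2 ⟨Prod.fst '' K, hK.image continuous_fst, fun a ha => ?_⟩
    rw [Set.mem_ofPred_eq, dist_zero_right]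
    exact lt_of_le_of_lt (norm_le_of_forall_le (half_pos hε).le
      fun b => (hKf (a, b) fun h => ha ⟨_, h, rfl⟩).le) (half_lt_self hε)

theorem AdmitsBump.zeroAtInfty_prod {k : ℕ∞} (h : AdmitsBump k C₀(A, C₀(B, E))) :
    AdmitsBump k C₀(A × B, E) := by
  refine h.of_norm_le (LinearMap.mkContinuous
    { toFun := fun f => f.curry, map_add' := fun _ _ => rfl, map_smul' := fun _ _ => rfl } 1
    fun f => ?_) fun f => ?_
  · rw [one_mul]
    exact norm_le_of_forall_le (norm_nonneg f) fun a =>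
      norm_le_of_forall_le (norm_nonneg f) fun b => norm_apply_le f (a, b)
  · exact norm_le_of_forall_le (norm_nonneg _) fun p =>
      (norm_apply_le (f.curry p.1) p.2).trans (norm_apply_le f.curry p.1)

theorem AdmitsBump.zeroAtInfty_congr {k : ℕ∞} (e : A ≃ₜ B) (h : AdmitsBump k C₀(A, E)) :
    AdmitsBump k C₀(B, E) := by
  refine h.of_norm_le (LinearMap.mkContinuous
    (compLinearMap (R := ℝ) ⟨⟨e, e.continuous⟩, e.isClosedEmbedding.tendsto_cocompact⟩) 1
    fun f => ?_) fun f => ?_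
  · rw [one_mul]
    exact norm_le_of_forall_le (norm_nonneg f) fun a => norm_apply_le f (e a)
  · refine norm_le_of_forall_le (norm_nonneg _) fun b => ?_
    obtain ⟨a, rfl⟩ := e.surjective b
    exact norm_apply_le (f.comp ⟨⟨e, e.continuous⟩, e.isClosedEmbedding.tendsto_cocompact⟩) a

theorem AdmitsBump.zeroAtInfty_unique {k : ℕ∞} [Unique A] (h : AdmitsBump k E) :
    AdmitsBump k C₀(A, E) := by
  refine h.of_norm_le (evalL default) fun f => norm_le_of_forall_le (norm_nonneg _) fun a => ?_
  rw [Subsingleton.elim a default]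
  rfl

/-- Splitting off the first factor of a finite product, as a homeomorphism. -/
def Fin.consProdHomeomorph {n : ℕ} (L : Fin (n + 1) → Type u) [∀ i, TopologicalSpace (L i)] :
    L 0 × ((i : Fin n) → L i.succ) ≃ₜ ((i : Fin (n + 1)) → L i) where
  toEquiv := Fin.consEquiv L
  continuous_toFun := by
    refine continuous_pi fun i => ?_
    refine Fin.cases ?_ (fun j => ?_) i
    · exact continuous_fst
    · exact (continuous_apply j).comp continuous_snd
  continuous_invFun :=
    (continuous_apply 0).prodMk (continuous_pi fun i => continuous_apply i.succ)

/-- The well-order case is applied with `C₀` of the remaining factors in place of `E`; the empty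
product is a point. -/
theorem AdmitsBump.zeroAtInfty_pi_ordinal {k : ℕ∞} (hE : AdmitsBump k E) (n : ℕ)
    (L : Fin n → Type u) [∀ i, TopologicalSpace (L i)]
    (hL : ∀ i, ∃ Ω : Ordinal.{v}, Nonempty (L i ≃ₜ Set.Iio Ω)) :
    AdmitsBump k C₀((i : Fin n) → L i, E) := by
  induction n with
  | zero => exact hE.zeroAtInfty_unique
  | succ n ih =>
    obtain ⟨Ω, ⟨e⟩⟩ := hL 0
    let : SuccOrder (Set.Iio Ω) := .ofLinearWellFoundedLT _
    have h := (ih (fun i => L i.succ) fun i => hL i.succ).zeroAtInfty_wellOrder (L := Set.Iio Ω)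
    exact (h.zeroAtInfty_congr e.symm).zeroAtInfty_prod.zeroAtInfty_congr
      (Fin.consProdHomeomorph L)

end Product

theorem proposition2 (k : ℕ∞) (hk : 1 ≤ k)
    (E : Type w) [NormedAddCommGroup E] [NormedSpace ℝ E] [CompleteSpace E]
    (hE : AdmitsBump k E) :
    (∀ (L : Type u) [TopologicalSpace L] [LocallyCompactSpace L],
      (∃ T : C₀(L, ℝ) → cZero L, Continuous T ∧
        (∀ f : C₀(L, ℝ), (toEllInfty f, T f) ∈ talagrandSet L ∪ {0}) ∧
        (∀ t : L, ContDiff ℝ k (fun f : C₀(L, ℝ) => (T f).1 t) ∧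
          DependsLocallyOnFinitelyManyCoords (fun f : C₀(L, ℝ) => (T f).1 t))) →
      AdmitsBump k C₀(L, E)) ∧
    (∀ (n : ℕ) (L : Fin n → Type u) [∀ i, TopologicalSpace (L i)],
      (∀ i, ∃ Ω : Ordinal.{v}, Nonempty (L i ≃ₜ Set.Iio Ω)) →
      AdmitsBump k C₀((i : Fin n) → L i, E)) := by
  exact ⟨fun L _ _ ⟨T, hT, hU, hc⟩ => hE.zeroAtInfty T hT hU hc,
    fun n L _ hL => hE.zeroAtInfty_pi_ordinal n L hL⟩
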